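/- Notation. A convex body in $\mathbb{R}^3$ is a compact convex set with non-empty interior. Let $K\subset\mathbb{R}^3$ be a convex body with $0\in K$ (the origin may lie on the boundary of $K$). Let $h_K(v)=\max_{x\in K}\langle x,v\rangle$ be its support function and $\varrho_K(w)=\max\{t\ge 0: tw\in K\}$, $w\in S^2$, its radial function. For $x\in\partial K$ let $\nu_K(x)\subset S^2$ be the set of exterior unit normals of $K$ at $x$, and for Borel $\omega\subset S^2$ let $\alpha_K^*(\omega)=\{w\in S^2:\ \nu_K(\varrho_K(w)w)\cap\omega\neq\emptyset\}$. For $q>0$ the $q$-th dual curvature measure of $K$ is the Borel measure on $S^2$ $$\widetilde C_{q,K}(\omega)=\int_{\alpha_K^*(\omega)}\varrho_K^{\,q}\,d\mathcal H^2,$$ where $\mathcal H^2$ is the surface area measure on $S^2$, and for $0\le p<1$ the $L_p$ $q$-th dual curvature measure of $K$ is $d\widetilde C_{p,q,K}=h_K^{-p}\,d\widetilde C_{q,K}$ (note that $\widetilde C_{q,K}(\{h_K=0\})=0$). The John ellipsoid of $K$ is the unique ellipsoid of maximal volume contained in $K$; let $0<r_1\le r_2\le r_3$ be the lengths of its half axes.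 Statement. Let $p\in[0,1)$, $q>2+p$ and $\lambda>1$. There exists a constant $C>1$, depending only on $\lambda$, $p$ and $q$, with the following property. If $K\subset\mathbb{R}^3$ is a convex body with $0\in K$ such that $$d\widetilde C_{p,q,K}=f\,d\mathcal H^2\ \text{ on } S^2$$ for some measurable function $f:S^2\to[\lambda^{-1},\lambda]$, then $$C^{-1}\,r_3^{\,3-q+p}\ \le\ r_1r_2r_3\ \le\ C\,r_3^{\,3-q+p},$$ and moreover $$r_3\ge C^{-1},\qquad r_1\le C,\qquad r_3^{\,q-p}\ \ge\ C^{-1}\,\frac{r_3}{r_1}.$$ -/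

import Mathlib

open MeasureTheory Metric

/-- Euclidean three-space. -/
abbrev E3 : Type := EuclideanSpace ℝ (Fin 3)

/-- The unit sphere `S²`. -/
abbrev S2 : Type := sphere (0 : E3) 1

/-- The surface area measure of `S²` (two-dimensional Hausdorff measure, normalized so that it
agrees with Lebesgue measure on planes; its total mass is `3 · vol (ball 0 1) = 4π`). -/
noncomputable def sphereArea : Measure S2 := (volume : Measure E3).toSphere

/-- The class of convex bodies in `ℝ³` (compact convex sets with non-empty interior)
that contain the origin, possibly on the boundary. -/
structure IsConvexBodyO (K : Set E3) : Prop where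
  convex : Convex ℝ K
  isCompact : IsCompact K
  interior_nonempty : (interior K).Nonempty
  zero_mem : (0 : E3) ∈ K

/-- The support function `h_K(v) = max {⟨x, v⟩ : x ∈ K}`. -/
noncomputable def supportFn (K : Set E3) (v : E3) : ℝ :=
  sSup ((fun x : E3 => inner ℝ x v) '' K)

/-- The radial function `ϱ_K(w) = max {t ≥ 0 : t w ∈ K}`. -/
noncomputable def radialFn (K : Set E3) (w : E3) : ℝ :=
  sSup {t : ℝ | 0 ≤ t ∧ t • w ∈ K}

/-- The set `ν_K(x)` of all exterior unit normals of `K` at the point `x`. -/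
def normals (K : Set E3) (x : E3) : Set S2 :=
  {v | ∀ y ∈ K, inner ℝ (y - x) (v : E3) ≤ 0}

open scoped Classical in
/-- The radial Gauss map: it sends `w ∈ S²` to an exterior unit normal of `K` at the
point `ϱ_K(w) w`. That point lies on the boundary of `K` for a convex body `K` containing the
origin, so that a normal exists there (the value `w` in the other case is never used). At almost
every `w` with `ϱ_K(w) > 0` the normal is unique, so that the choice of the normal
at the remaining `w` has no influence on the measures defined below. -/
noncomputable def radialGauss (K : Set E3) (w : S2) : S2 :=
  if h : (normals K (radialFn K w • (w : E3))).Nonempty then h.some else w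

/-- The `q`-th dual curvature measure of `K` on `S²`, for `q > 0`:
`ω ↦ ∫_{α*_K(ω)} ϱ_K ^ q dH²`, where `α*_K(ω)` is the set of all `w ∈ S²` such that some exterior
unit normal at `ϱ_K(w) w` lies in `ω`. As the normal at `ϱ_K(w) w` is unique for almost every `w`
with respect to `ϱ_K ^ q dH²`, the set `α*_K(ω)` is the preimage of `ω` under the radial Gauss map
up to a null set, and the measure is the image of `ϱ_K ^ q dH²` under this map. (Where the normal
is unique and `ϱ_K` is positive and continuous the radial Gauss map is continuous, so it is
almost everywhere measurable for `ϱ_K ^ q dH²`.) -/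
noncomputable def dualCurvature (q : ℝ) (K : Set E3) : Measure S2 :=
  (sphereArea.withDensity fun w => ENNReal.ofReal (radialFn K w ^ q)).map (radialGauss K)

/-- The `L_p` `q`-th dual curvature measure `dC̃_{p,q,K} = h_K ^ (-p) dC̃_{q,K}`. The value of the
density where `h_K` vanishes does not matter, since that set has `C̃_{q,K}`-measure zero. -/
noncomputable def lpDualCurvature (p q : ℝ) (K : Set E3) : Measure S2 :=
  (dualCurvature q K).withDensity fun v => ENNReal.ofReal (supportFn K v) ^ (-p)

/-- An ellipsoid with non-empty interior: the image of the closed unit ball under an invertible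
affine map. -/
def IsEllipsoid (S : Set E3) : Prop :=
  ∃ T : E3 ≃ᵃ[ℝ] E3, S = T '' closedBall 0 1

/-- `S` is the John ellipsoid of `K`: an ellipsoid of maximal volume among those inside `K`. -/
structure IsJohnEllipsoid (K S : Set E3) : Prop where
  isEllipsoid : IsEllipsoid S
  subset : S ⊆ K
  maximal : ∀ S' : Set E3, IsEllipsoid S' → S' ⊆ K → volume S' ≤ volume S

/-- The numbers `r 0, r 1, r 2 > 0` are the half axes (semi-axis lengths) of the ellipsoid `S`, for
some center `X` and some orthonormal basis `e` of principal directions. -/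
def HasHalfAxes (S : Set E3) (r : Fin 3 → ℝ) : Prop :=
  (∀ i, 0 < r i) ∧ ∃ (X : E3) (e : OrthonormalBasis (Fin 3) ℝ E3),
    S = {x : E3 | ∑ i, (inner ℝ (e i) (x - X) / r i) ^ 2 ≤ 1}

/-! Everything follows from one number, `I = ∫ ϱ_K ^ q`, the total mass of `dualCurvature q K`. In
polar coordinates `I = q ∫_K ‖x‖ ^ (q - 3)`. By John's theorem `K` is, up to constants, a box with
sides `r 0 ≤ r 1 ≤ r 2`; since `q - 3 > -1`, slicing along the longest axis shows that `I` is
comparable to `V * r 2 ^ (q - 3)`, where `V = r 0 * r 1 * r 2` (`setLIntegral_norm_rpow_le`,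
`le_setLIntegral_norm_rpow`). On the other hand `h_K ≤ 56 * r 2` everywhere, and `h_K ≥ r 2 / 2` on
a cap of fixed size around an end of the longest axis. Integrating `h_K ^ (-p)` against the dual
curvature measure over the sphere and over the cap, and using the bounds on `f`, makes `r 2 ^ (-p) *
I` comparable to `1`. Hence `V` is comparable to `r 2 ^ (3 - q + p)`. The remaining bounds are
arithmetic with the exponent `n = q - p > 2` (`halfAxes_bounds_of_volume_bounds`). -/

open MeasureTheory Metric

/-! ### Ellipsoids and a crude form of John's theorem. -/

/-- The volume of the affine image of the unit ball that is described by a matrix in coordinates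
with respect to an orthonormal basis. -/
theorem volume_matrix_image_closedBall (e : OrthonormalBasis (Fin 3) ℝ E3) (X : E3)
    (M : Matrix (Fin 3) (Fin 3) ℝ) :
    volume ((fun w : E3 => X + e.repr.symm (Matrix.toEuclideanLin M w)) '' closedBall 0 1) =
      ENNReal.ofReal |M.det| * volume (closedBall (0 : E3) 1) := by
  have h1 : (fun w : E3 => X + e.repr.symm (Matrix.toEuclideanLin M w)) '' closedBall 0 1 =
      (fun x => X + x) '' (e.repr.symm '' (Matrix.toEuclideanLin M '' closedBall 0 1)) := by
    simp only [Set.image_image]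
  have h2 : LinearMap.det (Matrix.toEuclideanLin M) = M.det := by
    rw [Matrix.toEuclideanLin_eq_toLin_orthonormal, LinearMap.det_toLin]
  have h3 : ∀ s : Set E3, volume (e.repr.symm '' s) = volume s := by
    intro s
    have h := e.measurePreserving_repr.measure_preimage_equiv (f := e.repr.toHomeomorph.toMeasurableEquiv) s
    rw [← h]
    congr 1
    ext x
    constructor
    · rintro ⟨y, hy, rfl⟩
      simpa using hy
    · intro hx
      exact ⟨e.repr x, hx, by simp⟩
  rw [h1, Set.image_add_left, measure_preimage_add, h3, Measure.addHaar_image_linearMap, h2]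

theorem isEllipsoid_matrix_image (e : OrthonormalBasis (Fin 3) ℝ E3) (X : E3)
    {M : Matrix (Fin 3) (Fin 3) ℝ} (hM : M.det ≠ 0) :
    IsEllipsoid ((fun w : E3 => X + e.repr.symm (Matrix.toEuclideanLin M w)) '' closedBall 0 1) := by
  have h2 : LinearMap.det (Matrix.toEuclideanLin M) ≠ 0 := by
    rwa [Matrix.toEuclideanLin_eq_toLin_orthonormal, LinearMap.det_toLin]
  let L : E3 ≃ₗ[ℝ] E3 := LinearMap.equivOfDetNeZero _ h2
  refine ⟨(L.trans e.repr.symm.toLinearEquiv).toAffineEquiv.trans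
    (AffineEquiv.constVAdd ℝ E3 X), ?_⟩
  rfl

/-- Points of the ellipsoid with half axes `r` in the coordinates of the unit ball. -/
theorem halfAxes_eq_image {e : OrthonormalBasis (Fin 3) ℝ E3} {X : E3} {r : Fin 3 → ℝ}
    (hr : ∀ i, 0 < r i) :
    {x : E3 | ∑ i, (inner ℝ (e i) (x - X) / r i) ^ 2 ≤ 1} =
      (fun w : E3 => X + e.repr.symm (Matrix.toEuclideanLin (Matrix.diagonal r) w)) ''
        closedBall 0 1 := by
  ext x
  simp only [Set.mem_ofPred_eq, Set.mem_image, mem_closedBall, dist_zero_right]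
  have key : ∀ w : E3, ‖w‖ ≤ 1 ↔ ∑ i, w i ^ 2 ≤ 1 := by
    intro w
    rw [← sq_le_one_iff₀ (norm_nonneg w), EuclideanSpace.norm_sq_eq]
    simp
  constructor
  · intro hx
    refine ⟨WithLp.toLp 2 fun i => inner ℝ (e i) (x - X) / r i, ?_, ?_⟩
    · rw [key]
      simpa using hx
    · rw [add_comm, ← eq_sub_iff_add_eq, LinearIsometryEquiv.symm_apply_eq]
      ext i
      simp [Matrix.mulVec_diagonal, e.repr_apply_apply, Matrix.toLpLin_apply,
        mul_div_cancel₀ _ (hr i).ne', inner_sub_right]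
  · rintro ⟨w, hw, rfl⟩
    rw [key] at hw
    have : ∀ i, inner ℝ (e i) (e.repr.symm (Matrix.toEuclideanLin (Matrix.diagonal r) w)) / r i
        = w i := by
      intro i
      rw [← e.repr_apply_apply]
      simp [Matrix.mulVec_diagonal, Matrix.toLpLin_apply, mul_div_cancel_left₀ _ (hr i).ne']
    simpa [this] using hw

/-- The matrix of the diagonal map with entries `2 / 3 * r j`, whose column `i` is replaced
by `z / 6`. -/
noncomputable def stretchMatrix (r z : Fin 3 → ℝ) (i : Fin 3) : Matrix (Fin 3) (Fin 3) ℝ :=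
  Matrix.of fun j k => if k = i then z j / 6 else if j = k then 2 / 3 * r j else 0

theorem det_stretchMatrix (r z : Fin 3 → ℝ) (i : Fin 3) :
    (stretchMatrix r z i).det * r i = 2 / 27 * z i * (r 0 * r 1 * r 2) := by
  fin_cases i <;> simp [stretchMatrix, Matrix.det_fin_three] <;> ring

/-- A crude form of John's theorem: a convex body is contained in a fixed multiple
of the box circumscribed to its ellipsoid of maximal volume. -/
theorem IsJohnEllipsoid.abs_inner_le {K : Set E3} (hK : Convex ℝ K)
    {e : OrthonormalBasis (Fin 3) ℝ E3} {X : E3} {r : Fin 3 → ℝ} (hr : ∀ i, 0 < r i)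
    (hE : IsJohnEllipsoid K {x : E3 | ∑ i, (inner ℝ (e i) (x - X) / r i) ^ 2 ≤ 1})
    {y : E3} (hy : y ∈ K) (i : Fin 3) : |inner ℝ (e i) (y - X)| ≤ 14 * r i := by
  set z : Fin 3 → ℝ := fun j => inner ℝ (e j) (y - X) with hz
  set M := stretchMatrix r z i with hM
  have hdet := det_stretchMatrix r z i
  have hr3 : 0 < r 0 * r 1 * r 2 := mul_pos (mul_pos (hr 0) (hr 1)) (hr 2)
  -- In this case the stretch matrix is singular and gives no competing ellipsoid.
  by_cases hzi : z i = 0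
  · rw [show inner ℝ (e i) (y - X) = 0 from hzi, abs_zero]
    linarith [hr i]
  have hM0 : M.det ≠ 0 := by
    intro h
    rw [← hM, h, zero_mul] at hdet
    have : 2 / 27 * z i * (r 0 * r 1 * r 2) ≠ 0 := by positivity
    exact this hdet.symm
  -- The competitor is stretched towards `y` and shrunk by `2 / 3` in the other directions. Its
  -- point with parameter `w` is `θ y + (1 - θ) (X + u)`, where `u` has no `i`-th coordinate. Since
  -- `θ ≤ 1 / 3`, the factor `2 / 3 / (1 - θ)` is at most `1`, so `X + u` stays in the John
  -- ellipsoid.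
  have hsub : (fun w : E3 => (X + (1 / 6 : ℝ) • (y - X)) +
      e.repr.symm (Matrix.toEuclideanLin M w)) '' closedBall 0 1 ⊆ K := by
    rintro _ ⟨w, hw, rfl⟩
    rw [mem_closedBall, dist_zero_right] at hw
    have hw2 : ∑ j, w j ^ 2 ≤ 1 := by
      have := (sq_le_one_iff₀ (norm_nonneg w)).2 hw
      rw [EuclideanSpace.norm_sq_eq] at this
      simpa using this
    have hwi : |w i| ≤ 1 := by
      rw [← sq_le_one_iff_abs_le_one]
      exact (Finset.single_le_sum (f := fun j => w j ^ 2) (fun j _ => sq_nonneg _)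
        (Finset.mem_univ i)).trans hw2
    obtain ⟨hw1, hw1'⟩ := abs_le.1 hwi
    set θ := (1 + w i) / 6 with hθ
    have hθ0 : 0 ≤ θ := by rw [hθ]; linarith
    have hθ1 : θ ≤ 1 / 3 := by rw [hθ]; linarith
    set u : E3 := WithLp.toLp 2 fun j => if j = i then 0 else 2 / 3 / (1 - θ) * (r j * w j) with hu
    have hmem : X + e.repr.symm u ∈ K := by
      apply hE.subset
      simp only [Set.mem_ofPred_eq, add_sub_cancel_left, ← e.repr_apply_apply,
        LinearIsometryEquiv.apply_symm_apply]
      refine le_trans (Finset.sum_le_sum fun j _ => ?_) hw2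
      simp only [hu]
      split_ifs with hj
      · simp [sq_nonneg]
      · have hq : 2 / 3 / (1 - θ) ≤ 1 := by
          rw [div_le_one (by linarith)]
          linarith
        have hq0 : 0 ≤ 2 / 3 / (1 - θ) := div_nonneg (by norm_num) (by linarith)
        have : 2 / 3 / (1 - θ) * (r j * w j) / r j = 2 / 3 / (1 - θ) * w j := by
          have := (hr j).ne'
          field_simp
        rw [this, mul_pow]
        exact mul_le_of_le_one_left (sq_nonneg _) (pow_le_one₀ hq0 hq)
    have hcomb := hK hy hmem hθ0 (by linarith : 0 ≤ 1 - θ) (by ring)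
    convert hcomb using 1
    apply e.repr.injective
    ext j
    have hz' : z j = e.repr y j - e.repr X j := by
      simp only [hz, ← e.repr_apply_apply, map_sub, PiLp.sub_apply]
    have hMw : (Matrix.toEuclideanLin M w) j =
        z j / 6 * w i + if j = i then 0 else 2 / 3 * r j * w j := by
      simp only [hM, Matrix.toLpLin_apply, Matrix.mulVec, dotProduct, stretchMatrix, Matrix.of_apply]
      rw [← Finset.add_sum_erase _ _ (Finset.mem_univ i)]
      simp only [if_true]
      congr 1
      split_ifs with hj
      · apply Finset.sum_eq_zero
        intro k hk
        have hk := Finset.ne_of_mem_erase hk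
        simp [hk, hj, hk.symm]
      · rw [Finset.sum_eq_single_of_mem j (by simp [hj])]
        · simp [hj]
        · intro k hk hkj
          have hk := Finset.ne_of_mem_erase hk
          simp [hk, hkj.symm]
    simp only [map_add, map_smul, map_sub, LinearIsometryEquiv.apply_symm_apply, PiLp.add_apply,
      PiLp.smul_apply, PiLp.sub_apply, smul_eq_mul, hMw, hz', hu]
    have h1θ : 1 - θ ≠ 0 := by linarith
    split_ifs with hj
    · rw [hθ]; ring
    · rw [mul_add (1 - θ), show (1 - θ) * (2 / 3 / (1 - θ) * (r j * w j)) = 2 / 3 * (r j * w j) by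
        field_simp, hθ]
      ring
  have hvol := hE.maximal _ (isEllipsoid_matrix_image e _ hM0) hsub
  rw [volume_matrix_image_closedBall, halfAxes_eq_image hr, volume_matrix_image_closedBall,
    ENNReal.mul_le_mul_iff_left (measure_closedBall_pos volume _ one_pos).ne'
      measure_closedBall_lt_top.ne, ENNReal.ofReal_le_ofReal_iff (abs_nonneg _)] at hvol
  have hdd : |(Matrix.diagonal r).det| = r 0 * r 1 * r 2 := by
    rw [Matrix.det_diagonal, Fin.prod_univ_three, abs_of_pos hr3]
  rw [hdd] at hvol
  have h1 : |M.det| * r i = 2 / 27 * |z i| * (r 0 * r 1 * r 2) := by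
    have h := congrArg abs hdet
    rw [abs_mul, abs_mul, abs_mul, abs_of_pos (hr i), abs_of_pos hr3,
      abs_of_pos (by norm_num : (0 : ℝ) < 2 / 27)] at h
    exact h
  -- Maximality gives `|z i| ≤ 27 / 2 * r i`, rounded up to `14 * r i`.
  have h2 : 2 / 27 * |z i| * (r 0 * r 1 * r 2) ≤ r i * (r 0 * r 1 * r 2) := by
    rw [← h1, mul_comm (r i)]
    exact mul_le_mul_of_nonneg_right hvol (hr i).le
  have h3 := le_of_mul_le_mul_right h2 hr3
  change |z i| ≤ _
  linarith [hr i]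

/-! ### The radial function and polar coordinates. -/

theorem setOf_smul_mem_eq_Icc_radialFn {K : Set E3} (hK : IsConvexBodyO K) (w : S2) :
    {t : ℝ | 0 ≤ t ∧ t • (w : E3) ∈ K} = Set.Icc 0 (radialFn K w) := by
  set A := {t : ℝ | 0 ≤ t ∧ t • (w : E3) ∈ K} with hA
  have hw : ‖(w : E3)‖ = 1 := by simp
  have h0 : (0 : ℝ) ∈ A := ⟨le_rfl, by simpa using hK.zero_mem⟩
  have hbdd : BddAbove A := by
    obtain ⟨R, hR⟩ := hK.isCompact.isBounded.exists_norm_le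
    refine ⟨R, fun t ht => ?_⟩
    have := hR _ ht.2
    rwa [norm_smul, hw, mul_one, Real.norm_of_nonneg ht.1] at this
  have hclosed : IsClosed A := by
    have : A = Set.Ici 0 ∩ (fun t : ℝ => t • (w : E3)) ⁻¹' K := rfl
    rw [this]
    exact isClosed_Ici.inter (hK.isCompact.isClosed.preimage (by fun_prop))
  have hmem : radialFn K w ∈ A := hclosed.csSup_mem ⟨0, h0⟩ hbdd
  ext t
  refine ⟨fun ht => ⟨ht.1, le_csSup hbdd ht⟩, fun ht => ⟨ht.1, ?_⟩⟩
  rcases hmem.1.eq_or_lt with h | h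
  · have : t = 0 := le_antisymm (ht.2.trans h.ge) ht.1
    simpa [this] using hK.zero_mem
  · have := hK.convex.smul_mem_of_zero_mem hK.zero_mem hmem.2
      ⟨div_nonneg ht.1 h.le, (div_le_one h).2 ht.2⟩
    rwa [smul_smul, div_mul_cancel₀ _ h.ne'] at this

theorem radialFn_nonneg (K : Set E3) (w : E3) : 0 ≤ radialFn K w :=
  Real.sSup_nonneg fun _ ht => ht.1

theorem lintegral_Ioc_rpow {a s : ℝ} (ha : 0 ≤ a) (hs : 0 < s) :
    ∫⁻ t in Set.Ioc 0 a, ENNReal.ofReal (t ^ (s - 1)) = ENNReal.ofReal (a ^ s / s) := by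
  rw [← ofReal_integral_eq_lintegral_ofReal, ← intervalIntegral.integral_of_le ha,
    integral_rpow (Or.inl (by linarith)), sub_add_cancel, Real.zero_rpow hs.ne', sub_zero]
  · refine (intervalIntegrable_iff_integrableOn_Ioc_of_le ha).1 ?_
    exact intervalIntegral.intervalIntegrable_rpow' (by linarith)
  · filter_upwards [ae_restrict_mem measurableSet_Ioc] with t ht
    exact Real.rpow_nonneg ht.1.le _

/-- Integration in polar coordinates in `ℝ³`. -/
theorem lintegral_eq_lintegral_sphereArea {g : E3 → ENNReal} (hg : Measurable g) :
    ∫⁻ x, g x = ∫⁻ w : S2, (∫⁻ t in Set.Ioi (0 : ℝ),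
      ENNReal.ofReal (t ^ 2) * g (t • (w : E3))) ∂sphereArea := by
  have hmp := (volume : Measure E3).measurePreserving_homeomorphUnitSphereProd
  have h1 : ∫⁻ x, g x = ∫⁻ x : ({0}ᶜ : Set E3), g (x : E3) ∂(Measure.comap Subtype.val volume) := by
    rw [lintegral_subtype_comap (measurableSet_singleton _).compl, restrict_compl_singleton]
  have h2 : ∫⁻ x : ({0}ᶜ : Set E3), g (x : E3) ∂(Measure.comap Subtype.val volume) =
      ∫⁻ z : S2 × Set.Ioi (0 : ℝ), g ((z.2 : ℝ) • (z.1 : E3))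
        ∂(sphereArea.prod (Measure.volumeIoiPow 2)) := by
    have h3 := hmp.lintegral_comp_emb (Homeomorph.measurableEmbedding _)
      (fun z : S2 × Set.Ioi (0 : ℝ) => g ((z.2 : ℝ) • (z.1 : E3)))
    rw [finrank_euclideanSpace_fin] at h3
    rw [sphereArea, ← h3]
    refine lintegral_congr fun x => ?_
    congr 1
    exact (congrArg Subtype.val ((homeomorphUnitSphereProd E3).symm_apply_apply x)).symm
  rw [h1, h2, lintegral_prod]
  · refine lintegral_congr fun w => ?_
    rw [Measure.volumeIoiPow, lintegral_withDensity_eq_lintegral_mul _ (by fun_prop) (by fun_prop)]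
    rw [← lintegral_subtype_comap measurableSet_Ioi]
    rfl
  · fun_prop

/-- On each ray the Jacobian `t ^ 2` turns `t ^ (q - 3)` into `t ^ (q - 1)`, whose integral up to
`ϱ_K` is `ϱ_K ^ q / q`. -/
theorem lintegral_radialFn_rpow {K : Set E3} (hK : IsConvexBodyO K) {q : ℝ} (hq : 0 < q) :
    ∫⁻ w : S2, ENNReal.ofReal (radialFn K w ^ q) ∂sphereArea =
      ENNReal.ofReal q * ∫⁻ x in K, ENNReal.ofReal (‖x‖ ^ (q - 3)) := by
  have hKm : MeasurableSet K := hK.isCompact.isClosed.measurableSet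
  rw [← lintegral_indicator hKm, lintegral_eq_lintegral_sphereArea
    (Measurable.indicator (by fun_prop) hKm), ← lintegral_const_mul' _ _ ENNReal.ofReal_ne_top]
  refine lintegral_congr fun w => ?_
  have hρ := radialFn_nonneg K w
  have hin : ∫⁻ t in Set.Ioi (0 : ℝ), ENNReal.ofReal (t ^ 2) *
      K.indicator (fun x => ENNReal.ofReal (‖x‖ ^ (q - 3))) (t • (w : E3)) =
      ∫⁻ t in Set.Ioc 0 (radialFn K w), ENNReal.ofReal (t ^ (q - 1)) := by
    rw [← lintegral_indicator measurableSet_Ioi, ← lintegral_indicator measurableSet_Ioc]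
    refine lintegral_congr fun t => ?_
    have hset := Set.ext_iff.1 (setOf_smul_mem_eq_Icc_radialFn hK w) t
    simp only [Set.mem_ofPred_eq, Set.mem_Icc] at hset
    by_cases ht : 0 < t
    · by_cases htK : t • (w : E3) ∈ K
      · have h := (hset.1 ⟨ht.le, htK⟩).2
        rw [Set.indicator_of_mem (Set.mem_Ioi.2 ht), Set.indicator_of_mem htK,
          Set.indicator_of_mem (Set.mem_Ioc.2 ⟨ht, h⟩), ← ENNReal.ofReal_mul (by positivity),
          norm_smul, Real.norm_of_nonneg ht.le, norm_eq_of_mem_sphere, mul_one,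
          ← Real.rpow_natCast, ← Real.rpow_add ht]
        congr 2
        push_cast
        ring
      · have h : t ∉ Set.Ioc 0 (radialFn K w) := fun h => htK (hset.2 ⟨ht.le, h.2⟩).2
        rw [Set.indicator_of_mem (Set.mem_Ioi.2 ht), Set.indicator_of_notMem htK,
          Set.indicator_of_notMem h, mul_zero]
    · rw [Set.indicator_of_notMem (by simpa using ht), Set.indicator_of_notMem (fun h => ht h.1)]
  rw [hin, lintegral_Ioc_rpow hρ hq, ← ENNReal.ofReal_mul hq.le, mul_div_cancel₀ _ hq.ne']

/-! ### Integrals of powers of the norm over a box-like body. -/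

theorem lintegral_fin_prod {n : ℕ} {g : Fin n → ℝ → ENNReal} (hg : ∀ i, Measurable (g i)) :
    ∫⁻ x : Fin n → ℝ, ∏ i, g i (x i) = ∏ i, ∫⁻ t, g i t := by
  induction n with
  | zero => simp [volume_pi]
  | succ n ih =>
    have h := (volume_preserving_piFinSuccAbove (fun _ : Fin (n + 1) => ℝ) 0).symm
    rw [← h.lintegral_comp_emb (MeasurableEquiv.measurableEmbedding _), Fin.prod_univ_succ,
      ← ih fun i => hg i.succ]
    simp_rw [MeasurableEquiv.piFinSuccAbove_symm_apply, Fin.insertNthEquiv,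
      Fin.prod_univ_succ, Fin.insertNth_zero, Equiv.coe_fn_mk, Fin.cons_succ, Fin.cons_zero]
    exact lintegral_prod_mul (μ := volume) (ν := volume) (g := fun y : Fin n → ℝ => ∏ i, g i.succ (y i)) (hg 0).aemeasurable
      (Finset.measurable_prod _ fun (i : Fin n) _ =>
        (hg i.succ).comp (measurable_pi_apply i)).aemeasurable

theorem lintegral_prod_orthonormalBasis (e : OrthonormalBasis (Fin 3) ℝ E3)
    {g : Fin 3 → ℝ → ENNReal} (hg : ∀ i, Measurable (g i)) :
    ∫⁻ x : E3, ∏ i, g i (inner ℝ (e i) x) = ∏ i, ∫⁻ t, g i t := by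
  rw [← lintegral_fin_prod hg, ← (PiLp.volume_preserving_ofLp (Fin 3)).lintegral_comp
    (f := fun x => ∏ i, g i (x i)) (by fun_prop),
    ← e.measurePreserving_repr.lintegral_comp (f := fun x : E3 => ∏ i, g i (x i)) (by fun_prop)]
  exact lintegral_congr fun x => by simp only [e.repr_apply_apply]

theorem ennreal_rpow_le_rpow_of_nonpos {a b : ENNReal} {s : ℝ} (hs : s ≤ 0) (h : a ≤ b) :
    b ^ s ≤ a ^ s := by
  rw [← neg_neg s, ENNReal.rpow_neg b, ENNReal.rpow_neg a, ENNReal.inv_le_inv]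
  exact ENNReal.rpow_le_rpow h (by linarith)

theorem abs_inner_le_norm_of_orthonormalBasis (e : OrthonormalBasis (Fin 3) ℝ E3) (i : Fin 3)
    (x : E3) : |inner ℝ (e i) x| ≤ ‖x‖ := by
  simpa using abs_real_inner_le_norm (e i) x

theorem lintegral_Icc_symm_comp_abs_le (a : ℝ) (F : ℝ → ENNReal) (hF : Measurable F) :
    ∫⁻ t in Set.Icc (-a) a, F |t| ≤ 2 * ∫⁻ t in Set.Ioc 0 a, F t := by
  have hpos : ∫⁻ t in Set.Icc 0 a, F |t| = ∫⁻ t in Set.Ioc 0 a, F t := by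
    rw [setLIntegral_congr Ioc_ae_eq_Icc.symm]
    exact setLIntegral_congr_fun measurableSet_Ioc fun t ht => by simp only [abs_of_pos ht.1]
  have hneg : ∫⁻ t in Set.Icc (-a) 0, F |t| = ∫⁻ t in Set.Icc 0 a, F |t| := by
    have h := (Measure.measurePreserving_neg (volume : Measure ℝ)).setLIntegral_comp_preimage
      (measurableSet_Icc (a := 0) (b := a)) (f := fun t => F |t|) (by fun_prop)
    simpa using h
  calc ∫⁻ t in Set.Icc (-a) a, F |t| ≤ ∫⁻ t in Set.Icc (-a) 0 ∪ Set.Icc 0 a, F |t| :=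
        lintegral_mono_set Set.Icc_subset_Icc_union_Icc
    _ ≤ _ := lintegral_union_le _ _ _
    _ = _ := by rw [hneg, hpos, two_mul]

/-- A slicing bound for integrals over a set inside a box. -/
theorem setLIntegral_le_of_box (e : OrthonormalBasis (Fin 3) ℝ E3) {K : Set E3}
    (hK : MeasurableSet K) {a : Fin 3 → ℝ}
    (hbox : ∀ x ∈ K, ∀ i, |inner ℝ (e i) x| ≤ a i) {G : E3 → ENNReal} {F : ℝ → ENNReal}
    (hF : Measurable F) (hG : ∀ x ∈ K, G x ≤ F |inner ℝ (e 2) x|) :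
    ∫⁻ x in K, G x ≤ ENNReal.ofReal (2 * a 0) * ENNReal.ofReal (2 * a 1) *
      (2 * ∫⁻ t in Set.Ioc 0 (a 2), F t) := by
  let g : Fin 3 → ℝ → ENNReal := fun i =>
    (Set.Icc (-a i) (a i)).indicator (if i = 2 then fun t => F |t| else 1)
  have hg : ∀ i, Measurable (g i) := by
    intro i
    refine Measurable.indicator ?_ measurableSet_Icc
    split_ifs
    · fun_prop
    · exact measurable_one
  have hle : ∫⁻ x in K, G x ≤ ∫⁻ x, ∏ i, g i (inner ℝ (e i) x) := by
    rw [← lintegral_indicator hK]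
    refine lintegral_mono fun x => ?_
    by_cases hx : x ∈ K
    · have hi : ∀ i, inner ℝ (e i) x ∈ Set.Icc (-a i) (a i) := fun i => abs_le.1 (hbox x hx i)
      rw [Set.indicator_of_mem hx, Fin.prod_univ_three]
      simp only [g, Set.indicator_of_mem (hi _)]
      simpa using hG x hx
    · simp [Set.indicator_of_notMem hx]
  refine hle.trans ?_
  rw [lintegral_prod_orthonormalBasis e hg, Fin.prod_univ_three]
  have h2 : ∫⁻ t, g 2 t ≤ 2 * ∫⁻ t in Set.Ioc 0 (a 2), F t := by
    simp only [g, if_true]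
    rw [lintegral_indicator measurableSet_Icc]
    exact lintegral_Icc_symm_comp_abs_le _ F hF
  have h0 : ∀ i, i ≠ 2 → ∫⁻ t, g i t = ENNReal.ofReal (2 * a i) := by
    intro i hi
    simp only [g, if_neg hi]
    rw [lintegral_indicator_one measurableSet_Icc, Real.volume_Icc]
    congr 1
    ring
  rw [h0 0 (by decide), h0 1 (by decide)]
  gcongr

/-- For `s ≥ 0` the integrand is bounded by its value at the largest norm. For `s < 0` it is bounded
by `|x₂| ^ s`, with `x₂` the coordinate along the longest axis; this is integrable near `0` because
`s > -1`. The two terms of the constant serve the two cases. -/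
theorem setLIntegral_norm_rpow_le (e : OrthonormalBasis (Fin 3) ℝ E3) {K : Set E3}
    (hK : MeasurableSet K) {r : Fin 3 → ℝ} (hr : ∀ i, 0 < r i)
    (hbox : ∀ x ∈ K, ∀ i, |inner ℝ (e i) x| ≤ 28 * r i) (hnorm : ∀ x ∈ K, ‖x‖ ≤ 56 * r 2)
    {s : ℝ} (hs : -1 < s) :
    ∫⁻ x in K, ENNReal.ofReal (‖x‖ ^ s) ≤
      ENNReal.ofReal (56 ^ 3 * (56 ^ s + 28 ^ s / (s + 1)) * (r 0 * r 1 * r 2 * r 2 ^ s)) := by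
  have h0 := hr 0
  have h1 := hr 1
  have h2 := hr 2
  have hs1 : 0 < s + 1 := by linarith
  rcases le_or_gt 0 s with h | h
  · refine (setLIntegral_le_of_box e hK hbox (F := fun _ => ENNReal.ofReal ((56 * r 2) ^ s))
      measurable_const fun x hx => ENNReal.ofReal_le_ofReal
        (Real.rpow_le_rpow (norm_nonneg _) (hnorm x hx) h)).trans ?_
    rw [setLIntegral_const, Real.volume_Ioc, ← ENNReal.ofReal_ofNat 2,
      ← ENNReal.ofReal_mul (by positivity), ← ENNReal.ofReal_mul (by positivity),
      ← ENNReal.ofReal_mul (by positivity), ← ENNReal.ofReal_mul (by positivity)]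
    apply ENNReal.ofReal_le_ofReal
    rw [Real.mul_rpow (by norm_num) h2.le]
    have : 0 ≤ 56 ^ 3 * (28 ^ s / (s + 1)) * (r 0 * r 1 * r 2 * r 2 ^ s) := by positivity
    linear_combination this
  -- The power is taken in `ENNReal`, where `0 ^ s = ∞` for `s < 0`: the bound must survive at
  -- points with `x₂ = 0` and `x ≠ 0`. The real power would be `0` there.
  · refine (setLIntegral_le_of_box e hK hbox (F := fun t => ENNReal.ofReal t ^ s)
      (by fun_prop) fun x hx => ?_).trans ?_
    · rcases (norm_nonneg x).eq_or_lt with hx0 | hx0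
      · rw [← hx0, Real.zero_rpow h.ne, ENNReal.ofReal_zero]
        exact zero_le
      · rw [← ENNReal.ofReal_rpow_of_pos hx0]
        exact ennreal_rpow_le_rpow_of_nonpos h.le
          (ENNReal.ofReal_le_ofReal (abs_inner_le_norm_of_orthonormalBasis e 2 x))
    · have hint : ∫⁻ t in Set.Ioc 0 (28 * r 2), ENNReal.ofReal t ^ s =
          ENNReal.ofReal ((28 * r 2) ^ (s + 1) / (s + 1)) := by
        rw [← lintegral_Ioc_rpow (by positivity) hs1, add_sub_cancel_right]
        exact setLIntegral_congr_fun measurableSet_Ioc fun t ht =>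
          ENNReal.ofReal_rpow_of_pos ht.1
      rw [hint, ← ENNReal.ofReal_ofNat 2,
        ← ENNReal.ofReal_mul (by positivity), ← ENNReal.ofReal_mul (by positivity),
        ← ENNReal.ofReal_mul (by positivity)]
      apply ENNReal.ofReal_le_ofReal
      rw [Real.mul_rpow (by norm_num) h2.le, Real.rpow_add_one (by norm_num),
        Real.rpow_add_one h2.ne']
      have : 0 ≤ 56 ^ 3 * 56 ^ s * (r 0 * r 1 * r 2 * r 2 ^ s) := by positivity
      linear_combination this

theorem min_rpow_mul_le_rpow {R y s : ℝ} (hR : 0 < R) (h1 : R / 2 ≤ y) (h2 : y ≤ 56 * R) :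
    min ((1 / 2) ^ s) (56 ^ s) * R ^ s ≤ y ^ s := by
  have hRs := Real.rpow_pos_of_pos hR s
  rcases le_or_gt 0 s with h | h
  · calc min ((1 / 2) ^ s) (56 ^ s) * R ^ s ≤ (1 / 2) ^ s * R ^ s := by
          gcongr
          exact min_le_left _ _
      _ = (R / 2) ^ s := by
          rw [← Real.mul_rpow (by norm_num) hR.le]
          congr 1
          ring
      _ ≤ y ^ s := Real.rpow_le_rpow (by positivity) h1 h
  · calc min ((1 / 2) ^ s) (56 ^ s) * R ^ s ≤ 56 ^ s * R ^ s := by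
          gcongr
          exact min_le_right _ _
      _ = (56 * R) ^ s := by rw [← Real.mul_rpow (by norm_num) hR.le]
      _ ≤ y ^ s := Real.rpow_le_rpow_of_nonpos (by linarith) h2 h.le

/-- It suffices to integrate over a small box in the ellipsoid on which the norm is comparable to `r
2`, so that the sign of `s` is irrelevant. -/
theorem le_setLIntegral_norm_rpow (e : OrthonormalBasis (Fin 3) ℝ E3) {K : Set E3}
    (hK : MeasurableSet K) {X : E3} {r : Fin 3 → ℝ} (hr : ∀ i, 0 < r i)
    (hsub : {x : E3 | ∑ i, (inner ℝ (e i) (x - X) / r i) ^ 2 ≤ 1} ⊆ K)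
    (hnorm : ∀ x ∈ K, ‖x‖ ≤ 56 * r 2) (s : ℝ) :
    ENNReal.ofReal (min ((1 / 2) ^ s) (56 ^ s) / 16 * (r 0 * r 1 * r 2 * r 2 ^ s)) ≤
      ∫⁻ x in K, ENNReal.ofReal (‖x‖ ^ s) := by
  have h0 := hr 0
  have h1 := hr 1
  have h2 := hr 2
  set k := min ((1 / 2 : ℝ) ^ s) (56 ^ s) with hk
  have hk0 : 0 < k := lt_min (by positivity) (by positivity)
  -- The sign `σ` makes the shift by `5 / 8 * r 2` along the longest axis point away from the
  -- origin, so `|x₂| ≥ r 2 / 2` on the box. The box lies in the ellipsoid as `1 / 16 + 1 / 16 + 9 /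
  -- 16 ≤ 1`, and its volume is `r 0 * r 1 * r 2 / 16`.
  obtain ⟨σ, hσ, hσX⟩ : ∃ σ : ℝ, (σ = 1 ∨ σ = -1) ∧ 0 ≤ σ * inner ℝ (e 2) X := by
    rcases le_total 0 (inner ℝ (e 2) X) with h | h
    · exact ⟨1, Or.inl rfl, by linarith⟩
    · exact ⟨-1, Or.inr rfl, by linarith⟩
  let m : Fin 3 → ℝ := fun i => inner ℝ (e i) X + if i = 2 then σ * (5 / 8 * r 2) else 0
  let d : Fin 3 → ℝ := fun i => if i = 2 then r 2 / 8 else r i / 4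
  let c : Fin 3 → ENNReal := fun i => if i = 2 then ENNReal.ofReal (k * r 2 ^ s) else 1
  let g : Fin 3 → ℝ → ENNReal := fun i =>
    (Set.Icc (m i - d i) (m i + d i)).indicator fun _ => c i
  have hg : ∀ i, Measurable (g i) := fun i => measurable_const.indicator measurableSet_Icc
  have hle : ∫⁻ x, ∏ i, g i (inner ℝ (e i) x) ≤ ∫⁻ x in K, ENNReal.ofReal (‖x‖ ^ s) := by
    rw [← lintegral_indicator hK]
    refine lintegral_mono fun x => ?_
    by_cases hx : ∀ i, inner ℝ (e i) x ∈ Set.Icc (m i - d i) (m i + d i)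
    · have hx0 := hx 0
      have hx1 := hx 1
      have hx2 := hx 2
      simp only [m, d, Set.mem_Icc, if_true, show (0 : Fin 3) ≠ 2 by decide,
        show (1 : Fin 3) ≠ 2 by decide, if_false, add_zero] at hx0 hx1 hx2
      have hsmall : ∀ {u v : ℝ} {ρ b : ℝ}, 0 < ρ → |u - v| ≤ b * ρ → ((u - v) / ρ) ^ 2 ≤ b ^ 2 := by
        intro u v ρ b hρ h
        rw [← sq_abs, abs_div, abs_of_pos hρ]
        exact pow_le_pow_left₀ (by positivity) ((div_le_iff₀ hρ).2 h) 2
      have hxK : x ∈ K := by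
        apply hsub
        rw [Set.mem_ofPred_eq, Fin.sum_univ_three]
        simp only [inner_sub_right]
        have q0 := hsmall (b := 1 / 4) h0 (u := inner ℝ (e 0) x) (v := inner ℝ (e 0) X)
          (abs_le.2 ⟨by linarith [hx0.1], by linarith [hx0.2]⟩)
        have q1 := hsmall (b := 1 / 4) h1 (u := inner ℝ (e 1) x) (v := inner ℝ (e 1) X)
          (abs_le.2 ⟨by linarith [hx1.1], by linarith [hx1.2]⟩)
        have q2 := hsmall (b := 3 / 4) h2 (u := inner ℝ (e 2) x) (v := inner ℝ (e 2) X) (by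
          rw [abs_le]
          rcases hσ with rfl | rfl <;> constructor <;> linarith [hx2.1, hx2.2])
        linarith
      have hlow : r 2 / 2 ≤ ‖x‖ := by
        refine le_trans ?_ (abs_inner_le_norm_of_orthonormalBasis e 2 x)
        rcases hσ with rfl | rfl
        · refine le_trans ?_ (le_abs_self _)
          linarith [hx2.1]
        · refine le_trans ?_ (neg_le_abs _)
          linarith [hx2.2]
      rw [Set.indicator_of_mem hxK, Fin.prod_univ_three]
      simp only [g, Set.indicator_of_mem (hx _)]
      simp only [c, if_true, show (0 : Fin 3) ≠ 2 by decide, show (1 : Fin 3) ≠ 2 by decide,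
        if_false, one_mul]
      exact ENNReal.ofReal_le_ofReal (min_rpow_mul_le_rpow h2 hlow (hnorm x hxK))
    · push Not at hx
      obtain ⟨i, hi⟩ := hx
      rw [Finset.prod_eq_zero (Finset.mem_univ i) (Set.indicator_of_notMem hi _)]
      exact zero_le
  refine le_trans (le_of_eq ?_) hle
  rw [lintegral_prod_orthonormalBasis e hg, Fin.prod_univ_three]
  have hint : ∀ i, ∫⁻ t, g i t = c i * ENNReal.ofReal (2 * d i) := by
    intro i
    simp only [g]
    rw [lintegral_indicator measurableSet_Icc, setLIntegral_const, Real.volume_Icc]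
    congr 2
    ring
  simp only [hint, c, d, if_true, show (0 : Fin 3) ≠ 2 by decide, show (1 : Fin 3) ≠ 2 by decide,
        if_false, one_mul]
  rw [← ENNReal.ofReal_mul (by positivity), ← ENNReal.ofReal_mul (by positivity),
    ← ENNReal.ofReal_mul (by positivity)]
  congr 1
  ring

/-! ### Mass comparison for the dual curvature measures. -/

theorem sphereArea_univ_pos : 0 < sphereArea Set.univ := by
  rw [Measure.measure_univ_pos]
  exact Measure.toSphere_ne_zero _

instance : IsFiniteMeasure sphereArea := inferInstanceAs (IsFiniteMeasure (Measure.toSphere _))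

section Density

variable {p q lam : ℝ} {K : Set E3} {f : S2 → ℝ}

/-- If the `L_p` dual curvature measure is non-zero, the radial Gauss map is almost everywhere
measurable, and the dual curvature measure has the expected total mass. -/
theorem dualCurvature_univ (hlam : 0 < lam) (hf : ∀ v, lam⁻¹ ≤ f v)
    (h : lpDualCurvature p q K = sphereArea.withDensity (fun v => ENNReal.ofReal (f v))) :
    dualCurvature q K Set.univ = ∫⁻ w : S2, ENNReal.ofReal (radialFn K w ^ q) ∂sphereArea := by
  by_cases hG : AEMeasurable (radialGauss K)
      (sphereArea.withDensity fun w => ENNReal.ofReal (radialFn K w ^ q))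
  · rw [dualCurvature, Measure.map_apply_of_aemeasurable hG MeasurableSet.univ, Set.preimage_univ,
      withDensity_apply _ MeasurableSet.univ, Measure.restrict_univ]
  -- `Measure.map` is zero for a map that is not almost everywhere measurable, while the lower bound
  -- on `f` makes the total mass positive.
  · exfalso
    have h0 : dualCurvature q K = 0 := Measure.map_of_not_aemeasurable hG
    have h1 := congrArg (fun μ : Measure S2 => μ Set.univ) h
    simp only [lpDualCurvature, h0, withDensity_zero_left, Measure.coe_zero, Pi.zero_apply,
      withDensity_apply _ MeasurableSet.univ, Measure.restrict_univ] at h1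
    have h2 : ENNReal.ofReal lam⁻¹ * sphereArea Set.univ ≤ ∫⁻ v, ENNReal.ofReal (f v) ∂sphereArea := by
      rw [← lintegral_const]
      exact lintegral_mono fun v => ENNReal.ofReal_le_ofReal (hf v)
    rw [← h1] at h2
    have h3 : 0 < ENNReal.ofReal lam⁻¹ * sphereArea Set.univ :=
      ENNReal.mul_pos (ENNReal.ofReal_pos.2 (inv_pos.2 hlam)).ne' sphereArea_univ_pos.ne'
    exact absurd h2 (not_le.2 h3)

/-- Total masses are compared, with `h_K ^ (-p) ≥ b ^ (-p)`. Zeros of `h_K` do no harm: in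
`ENNReal`, `0 ^ (-p)` is `∞`, or `1` if `p = 0`. -/
theorem lintegral_radialFn_rpow_le (hp : 0 ≤ p) (hlam : 0 < lam)
    (hf : ∀ v, lam⁻¹ ≤ f v ∧ f v ≤ lam)
    (h : lpDualCurvature p q K = sphereArea.withDensity (fun v => ENNReal.ofReal (f v)))
    {b : ℝ} (hb : 0 < b) (hKb : ∀ v : S2, supportFn K v ≤ b) :
    ENNReal.ofReal (b ^ (-p)) * ∫⁻ w : S2, ENNReal.ofReal (radialFn K w ^ q) ∂sphereArea ≤
      ENNReal.ofReal lam * sphereArea Set.univ := by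
  have h1 := congrArg (fun μ : Measure S2 => μ Set.univ) h
  simp only [lpDualCurvature, withDensity_apply _ MeasurableSet.univ, Measure.restrict_univ] at h1
  calc _ = ∫⁻ _, ENNReal.ofReal (b ^ (-p)) ∂(dualCurvature q K) := by
        rw [lintegral_const, dualCurvature_univ hlam (fun v => (hf v).1) h]
    _ ≤ ∫⁻ v, ENNReal.ofReal (supportFn K v) ^ (-p) ∂(dualCurvature q K) := by
        refine lintegral_mono fun v => ?_
        rw [← ENNReal.ofReal_rpow_of_pos hb]
        exact ennreal_rpow_le_rpow_of_nonpos (by linarith) (ENNReal.ofReal_le_ofReal (hKb v))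
    _ = ∫⁻ v, ENNReal.ofReal (f v) ∂sphereArea := h1
    _ ≤ ∫⁻ _, ENNReal.ofReal lam ∂sphereArea :=
        lintegral_mono fun v => ENNReal.ofReal_le_ofReal (hf v).2
    _ = _ := lintegral_const _

/-- The masses of `ω` are compared; the dual curvature of `ω` is then bounded by its total mass. -/
theorem le_lintegral_radialFn_rpow (hp : 0 ≤ p) (hlam : 0 < lam)
    (hf : ∀ v, lam⁻¹ ≤ f v)
    (h : lpDualCurvature p q K = sphereArea.withDensity (fun v => ENNReal.ofReal (f v)))
    {b : ℝ} (hb : 0 < b) {ω : Set S2} (hω : MeasurableSet ω)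
    (hKb : ∀ v ∈ ω, b ≤ supportFn K v) :
    ENNReal.ofReal lam⁻¹ * sphereArea ω ≤
      ENNReal.ofReal (b ^ (-p)) * ∫⁻ w : S2, ENNReal.ofReal (radialFn K w ^ q) ∂sphereArea := by
  have h1 := congrArg (fun μ : Measure S2 => μ ω) h
  simp only [lpDualCurvature, withDensity_apply _ hω] at h1
  calc _ = ∫⁻ _ in ω, ENNReal.ofReal lam⁻¹ ∂sphereArea := (setLIntegral_const _ _).symm
    _ ≤ ∫⁻ v in ω, ENNReal.ofReal (f v) ∂sphereArea :=
        lintegral_mono fun v => ENNReal.ofReal_le_ofReal (hf v)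
    _ = ∫⁻ v in ω, ENNReal.ofReal (supportFn K v) ^ (-p) ∂(dualCurvature q K) := h1.symm
    _ ≤ ∫⁻ _ in ω, ENNReal.ofReal (b ^ (-p)) ∂(dualCurvature q K) := by
        refine setLIntegral_mono' hω fun v hv => ?_
        rw [← ENNReal.ofReal_rpow_of_pos hb]
        exact ennreal_rpow_le_rpow_of_nonpos (by linarith) (ENNReal.ofReal_le_ofReal (hKb v hv))
    _ ≤ ENNReal.ofReal (b ^ (-p)) * dualCurvature q K Set.univ := by
        rw [setLIntegral_const]
        gcongr
        exact Set.subset_univ _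
    _ = _ := by rw [dualCurvature_univ hlam hf h]

end Density

/-! ### Support function bounds and arithmetic of the half axes. -/

theorem IsConvexBodyO.inner_le_supportFn {K : Set E3} (hK : IsConvexBodyO K) {x : E3} (hx : x ∈ K)
    (v : E3) : inner ℝ x v ≤ supportFn K v :=
  le_csSup (hK.isCompact.image (by fun_prop)).bddAbove ⟨x, hx, rfl⟩

theorem IsConvexBodyO.supportFn_le {K : Set E3} (hK : IsConvexBodyO K) {b : ℝ}
    (hb : ∀ x ∈ K, ‖x‖ ≤ b) (v : S2) : supportFn K v ≤ b := by
  refine csSup_le ⟨_, 0, hK.zero_mem, rfl⟩ ?_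
  rintro _ ⟨x, hx, rfl⟩
  refine (real_inner_le_norm x v).trans ?_
  rw [norm_eq_of_mem_sphere, mul_one]
  exact hb x hx

/-- The radius `1 / 112` is chosen so that moving `u` to `v` changes the inner product with `x` by
at most `56 * R / 112 = R / 2`. -/
theorem IsConvexBodyO.le_supportFn_of_mem_ball {K : Set E3} (hK : IsConvexBodyO K) {R : ℝ}
    {x : E3} (hx : x ∈ K) (hxR : ‖x‖ ≤ 56 * R) {u : S2} (hu : R ≤ inner ℝ x (u : E3)) {v : S2}
    (hv : v ∈ ball u (1 / 112)) : R / 2 ≤ supportFn K v := by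
  have h1 := hK.inner_le_supportFn hx v
  have h2 : |inner ℝ x ((v : E3) - u)| ≤ R / 2 := by
    have hd : ‖(v : E3) - u‖ ≤ 1 / 112 := by
      rw [← dist_eq_norm]
      exact (mem_ball.1 hv).le
    calc _ ≤ ‖x‖ * ‖(v : E3) - u‖ := abs_real_inner_le_norm _ _
      _ ≤ (56 * R) * (1 / 112) :=
        mul_le_mul hxR hd (norm_nonneg _) ((norm_nonneg _).trans hxR)
      _ = R / 2 := by ring
  rw [inner_sub_right] at h2
  linarith [(abs_le.1 h2).1]

/-- With `R = r 2`, the lower volume bound and `r 1 ≤ R` give `a * R ≤ R ^ n * r 0`, which is the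
last claim; with `r 0 ≤ R` it yields `R ≥ a ^ (1 / n)`. Then `r 0 ^ 2 ≤ r 0 * r 1 ≤ b * R ^ (2 - n)`
is bounded because `2 - n < 0`. -/
theorem halfAxes_bounds_of_volume_bounds {a b n : ℝ} (ha : 0 < a) (hb : 0 < b) (hn : 2 < n) :
    ∃ C : ℝ, 1 < C ∧ ∀ r : Fin 3 → ℝ, (∀ i, 0 < r i) → r 0 ≤ r 1 → r 1 ≤ r 2 →
      a * r 2 ^ (3 - n) ≤ r 0 * r 1 * r 2 → r 0 * r 1 * r 2 ≤ b * r 2 ^ (3 - n) →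
        (C⁻¹ * r 2 ^ (3 - n) ≤ r 0 * r 1 * r 2 ∧ r 0 * r 1 * r 2 ≤ C * r 2 ^ (3 - n)) ∧
          C⁻¹ ≤ r 2 ∧ r 0 ≤ C ∧ C⁻¹ * (r 2 / r 0) ≤ r 2 ^ n := by
  set m := a ^ n⁻¹ with hm
  have hm0 : 0 < m := Real.rpow_pos_of_pos ha _
  have hbm : 0 < b * m ^ (2 - n) := mul_pos hb (Real.rpow_pos_of_pos hm0 _)
  have ha' := inv_pos.2 ha
  have hm' := inv_pos.2 hm0
  set C := 2 + b + a⁻¹ + m⁻¹ + b * m ^ (2 - n) with hC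
  have hC0 : 0 < C := by positivity
  have hCa : C⁻¹ ≤ a := inv_le_of_inv_le₀ ha (by linarith)
  have hCm : C⁻¹ ≤ m := inv_le_of_inv_le₀ hm0 (by linarith)
  refine ⟨C, by linarith, fun r hr h01 h12 hl hu => ?_⟩
  have h0 := hr 0
  have h1 := hr 1
  have h2 := hr 2
  set R := r 2 with hR
  have hRn : 0 < R ^ n := Real.rpow_pos_of_pos h2 _
  have hR3 : 0 < R ^ (3 - n) := Real.rpow_pos_of_pos h2 _
  have hmul : R ^ (3 - n) * R ^ n = R ^ 3 := by
    rw [← Real.rpow_add h2, sub_add_cancel]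
    exact Real.rpow_natCast R 3
  have hVn : a * R ^ 3 ≤ r 0 * r 1 * R * R ^ n := by
    rw [← hmul, ← mul_assoc]
    exact mul_le_mul_of_nonneg_right hl hRn.le
  have hlast : a * R ≤ R ^ n * r 0 := by
    have : a * R * R ^ 2 ≤ R ^ n * r 0 * R ^ 2 := by
      have : r 1 * (r 0 * R * R ^ n) ≤ R * (r 0 * R * R ^ n) :=
        mul_le_mul_of_nonneg_right h12 (by positivity)
      linarith
    exact le_of_mul_le_mul_right this (by positivity)
  have hRna : a ≤ R ^ n := by
    have : a * R ≤ R ^ n * R :=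
      hlast.trans (mul_le_mul_of_nonneg_left (h01.trans h12) hRn.le)
    exact le_of_mul_le_mul_right this h2
  have hmR : m ≤ R := by
    have := Real.rpow_le_rpow ha.le hRna (inv_pos.2 (by linarith : 0 < n)).le
    rwa [Real.rpow_rpow_inv h2.le (by linarith)] at this
  refine ⟨⟨(mul_le_mul_of_nonneg_right hCa hR3.le).trans hl,
    hu.trans (mul_le_mul_of_nonneg_right (by linarith) hR3.le)⟩, hCm.trans hmR, ?_, ?_⟩
  · have hR2 : R ^ (3 - n) = R ^ (2 - n) * R := by
      rw [← Real.rpow_add_one h2.ne']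
      congr 1
      ring
    have h3 : r 0 * r 1 ≤ b * R ^ (2 - n) := by
      rw [hR2, ← mul_assoc] at hu
      exact le_of_mul_le_mul_right hu h2
    have h4 : R ^ (2 - n) ≤ m ^ (2 - n) :=
      Real.rpow_le_rpow_of_nonpos hm0 hmR (by linarith)
    have h5 : r 0 * r 0 ≤ b * m ^ (2 - n) :=
      (mul_le_mul_of_nonneg_left h01 h0.le).trans
        (h3.trans (mul_le_mul_of_nonneg_left h4 hb.le))
    have h6 := sq_nonneg (r 0 - 1)
    linarith
  · rw [← mul_div_assoc, div_le_iff₀ h0]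
    exact (mul_le_mul_of_nonneg_right hCa h2.le).trans hlast

/-! ### The main theorem. -/

theorem lemma4p1 (p q lam : ℝ) (hp0 : 0 ≤ p) (hp1 : p < 1) (hq : 2 + p < q) (hlam : 1 < lam) :
    ∃ C : ℝ, 1 < C ∧
      ∀ (K E : Set E3) (f : S2 → ℝ) (r : Fin 3 → ℝ),
        IsConvexBodyO K →
        Measurable f → (∀ v, lam⁻¹ ≤ f v ∧ f v ≤ lam) →
        lpDualCurvature p q K = sphereArea.withDensity (fun v => ENNReal.ofReal (f v)) →
        IsJohnEllipsoid K E → HasHalfAxes E r → r 0 ≤ r 1 → r 1 ≤ r 2 →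
          (C⁻¹ * r 2 ^ (3 - q + p) ≤ r 0 * r 1 * r 2 ∧
            r 0 * r 1 * r 2 ≤ C * r 2 ^ (3 - q + p)) ∧
          C⁻¹ ≤ r 2 ∧ r 0 ≤ C ∧ C⁻¹ * (r 2 / r 0) ≤ r 2 ^ (q - p) := by
  have hlam0 : 0 < lam := by linarith
  have hq0 : 0 < q := by linarith
  have hs1 : 0 < q - 3 + 1 := by linarith
  set A := (sphereArea Set.univ).toReal with hA
  have hA0 : 0 < A := ENNReal.toReal_pos sphereArea_univ_pos.ne' (measure_ne_top _ _)
  -- A lower bound, independent of the centre, for the area of a cap of radius `1 / 112`.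
  set κ : ℝ := (Measure.toSphereBallBound 3 (1 / 112) : ℝ) * (volume (ball (0 : E3) 1)).toReal
    with hκ
  have hκ0 : 0 < κ := mul_pos (by exact_mod_cast Measure.toSphereBallBound_pos _ _)
    (ENNReal.toReal_pos (measure_ball_pos _ _ one_pos).ne' measure_ball_lt_top.ne)
  set cU : ℝ := q * (56 ^ 3 * (56 ^ (q - 3) + 28 ^ (q - 3) / (q - 3 + 1))) with hcU
  have hcU0 : 0 < cU := by positivity
  set cL : ℝ := q * (min ((1 / 2) ^ (q - 3)) (56 ^ (q - 3)) / 16) with hcL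
  have hcL0 : 0 < cL := by
    have : 0 < min ((1 / 2 : ℝ) ^ (q - 3)) (56 ^ (q - 3)) := lt_min (by positivity) (by positivity)
    positivity
  obtain ⟨C, hC1, hC⟩ := halfAxes_bounds_of_volume_bounds (n := q - p)
    (a := lam⁻¹ * κ / ((1 / 2) ^ (-p) * cU)) (b := lam * A / (56 ^ (-p) * cL))
    (by positivity) (by positivity) (by linarith)
  refine ⟨C, hC1, fun K E f r hK _ hf h hE hEr h01 h12 => ?_⟩
  obtain ⟨hr, X, e, rfl⟩ := hEr
  have h0 := hr 0
  have h1 := hr 1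
  have h2 := hr 2
  have hKm : MeasurableSet K := hK.isCompact.isClosed.measurableSet
  -- The origin lies in `K`, so the John bound applies to both `x` and `0`, and `28 = 14 + 14`.
  have hbox : ∀ x ∈ K, ∀ i, |inner ℝ (e i) x| ≤ 28 * r i := by
    intro x hx i
    have hx1 := abs_le.1 (hE.abs_inner_le hK.convex hr hx i)
    have hx0 := abs_le.1 (hE.abs_inner_le hK.convex hr hK.zero_mem i)
    rw [inner_sub_right] at hx1 hx0
    rw [inner_zero_right] at hx0
    rw [abs_le]
    constructor <;> linarith [hx1.1, hx1.2, hx0.1, hx0.2]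
  -- The constant comes from `3 * 28 ^ 2 ≤ 56 ^ 2`.
  have hnorm : ∀ x ∈ K, ‖x‖ ≤ 56 * r 2 := by
    intro x hx
    have hle : ∀ i, r i ≤ r 2 := by
      intro i
      fin_cases i
      exacts [h01.trans h12, h12, le_rfl]
    have hsq : ∀ i, inner ℝ (e i) x ^ 2 ≤ (28 * r 2) ^ 2 := fun i =>
      sq_le_sq' (by linarith [(abs_le.1 (hbox x hx i)).1, hle i])
        (by linarith [(abs_le.1 (hbox x hx i)).2, hle i])
    have hsum := e.sum_sq_inner_right x
    rw [Fin.sum_univ_three] at hsum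
    refine (sq_le_sq₀ (norm_nonneg _) (by positivity)).1 ?_
    have := sq_nonneg (r 2)
    linarith [hsq 0, hsq 1, hsq 2]
  set W := r 0 * r 1 * r 2 * r 2 ^ (q - 3) with hW
  have hW0 : 0 < W := by positivity
  set I := ∫⁻ w : S2, ENNReal.ofReal (radialFn K w ^ q) ∂sphereArea with hI
  have hIU : I ≤ ENNReal.ofReal (cU * W) := by
    rw [hI, lintegral_radialFn_rpow hK hq0, hcU, mul_assoc q, ENNReal.ofReal_mul hq0.le]
    gcongr
    exact setLIntegral_norm_rpow_le e hKm hr hbox hnorm (by linarith)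
  have hIL : ENNReal.ofReal (cL * W) ≤ I := by
    rw [hI, lintegral_radialFn_rpow hK hq0, hcL, mul_assoc q, ENNReal.ofReal_mul hq0.le]
    gcongr
    exact le_setLIntegral_norm_rpow e hKm hr hE.subset hnorm _
  have hupper : (56 * r 2) ^ (-p) * (cL * W) ≤ lam * A := by
    have h3 := lintegral_radialFn_rpow_le hp0 hlam0 hf h (by positivity : 0 < 56 * r 2)
      (hK.supportFn_le hnorm)
    rw [← ENNReal.ofReal_toReal (measure_ne_top sphereArea Set.univ),
      ← ENNReal.ofReal_mul hlam0.le] at h3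
    have h4 := (mul_le_mul_right hIL (ENNReal.ofReal ((56 * r 2) ^ (-p)))).trans h3
    rwa [← ENNReal.ofReal_mul (by positivity), ENNReal.ofReal_le_ofReal_iff (by positivity)] at h4
  -- `x` is an end `X + τ r₂ e₂` of the longest axis and `u = τ e₂`, with the sign `τ` chosen so
  -- that the centre contributes non-negatively to `⟨x, u⟩`.
  obtain ⟨x, u, hx, hxu⟩ : ∃ (x : E3) (u : S2), x ∈ K ∧ r 2 ≤ inner ℝ x (u : E3) := by
    have hpt : ∀ τ : ℝ, τ ^ 2 = 1 → X + (τ * r 2) • e 2 ∈ K := by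
      intro τ hτ
      apply hE.subset
      rw [Set.mem_ofPred_eq, Fin.sum_univ_three]
      simp [inner_smul_right, e.inner_eq_ite, mul_div_cancel_right₀ _ h2.ne', hτ]
    have hin : ∀ τ : ℝ, τ ^ 2 = 1 →
        inner ℝ (X + (τ * r 2) • e 2) (τ • e 2) = τ * inner ℝ X (e 2) + r 2 := by
      intro τ hτ
      simp only [inner_add_left, inner_smul_left, inner_smul_right, e.inner_eq_one,
        RCLike.conj_to_real, mul_one]
      linear_combination r 2 * hτ
    have hmain : ∀ τ : ℝ, τ ^ 2 = 1 → 0 ≤ τ * inner ℝ X (e 2) →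
        ∃ (x : E3) (u : S2), x ∈ K ∧ r 2 ≤ inner ℝ x (u : E3) := by
      intro τ hτ hτX
      refine ⟨X + (τ * r 2) • e 2, ⟨τ • e 2, ?_⟩, hpt τ hτ, ?_⟩
      · rw [mem_sphere_zero_iff_norm, norm_smul, e.norm_eq_one, mul_one, Real.norm_eq_abs]
        rcases mul_self_eq_one_iff.1 ((sq τ).symm.trans hτ) with rfl | rfl <;> simp
      · change r 2 ≤ inner ℝ (X + (τ * r 2) • e 2) (τ • e 2)
        rw [hin τ hτ]
        linarith
    rcases le_total 0 (inner ℝ X (e 2)) with h | h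
    · exact hmain 1 (by norm_num) (by linarith)
    · exact hmain (-1) (by norm_num) (by linarith)
  have hlower : lam⁻¹ * κ ≤ (r 2 / 2) ^ (-p) * (cU * W) := by
    have h3 := le_lintegral_radialFn_rpow hp0 hlam0 (fun v => (hf v).1) h
      (by positivity : 0 < r 2 / 2) (measurableSet_ball (x := u) (ε := 1 / 112))
      fun v hv => hK.le_supportFn_of_mem_ball hx (hnorm x hx) hxu hv
    have h4 : ENNReal.ofReal κ ≤ sphereArea (ball u (1 / 112)) := by
      have h5 := Measure.toSphereBallBound_mul_measure_unitBall_le_toSphere_ball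
        (volume : Measure E3) (by norm_num : (0 : ℝ) < 1 / 112) u
      rw [finrank_euclideanSpace_fin] at h5
      rw [hκ, ENNReal.ofReal_mul (NNReal.coe_nonneg _), ENNReal.ofReal_coe_nnreal,
        ENNReal.ofReal_toReal measure_ball_lt_top.ne]
      exact h5
    have h6 := (mul_le_mul_right h4 (ENNReal.ofReal lam⁻¹)).trans
      (h3.trans (mul_le_mul_right hIU _))
    rwa [← ENNReal.ofReal_mul (by positivity), ← ENNReal.ofReal_mul (by positivity),
      ENNReal.ofReal_le_ofReal_iff (by positivity)] at h6
  rw [show 3 - q + p = 3 - (q - p) by ring]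
  have hWV : r 2 ^ (-p) * W * r 2 ^ (3 - (q - p)) = r 0 * r 1 * r 2 := by
    have : r 2 ^ (-p) * r 2 ^ (q - 3) * r 2 ^ (3 - (q - p)) = 1 := by
      rw [← Real.rpow_add h2, ← Real.rpow_add h2,
        show -p + (q - 3) + (3 - (q - p)) = 0 by ring, Real.rpow_zero]
    rw [hW]
    linear_combination (r 0 * r 1 * r 2) * this
  have hpow : 0 ≤ r 2 ^ (3 - (q - p)) := by positivity
  refine hC r hr h01 h12 ?_ ?_
  · rw [← hWV]
    refine mul_le_mul_of_nonneg_right ?_ hpow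
    rw [div_le_iff₀ (by positivity)]
    rw [div_eq_mul_one_div, Real.mul_rpow h2.le (by norm_num)] at hlower
    linarith
  · rw [← hWV]
    refine mul_le_mul_of_nonneg_right ?_ hpow
    rw [le_div_iff₀ (by positivity)]
    rw [Real.mul_rpow (by norm_num) h2.le] at hupper
    linarith
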